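/- For $x,y\in[0,1)$ let $I(x,y)=[x,y)$ if $x\le y$ and $I(x,y)=[0,y)\cup[x,1)$ if $x>y$; for $\boldsymbol{x},\boldsymbol{y}\in[0,1)^d$ let $B(\boldsymbol{x},\boldsymbol{y})=I(x_1,y_1)\times\cdots\times I(x_d,y_d)$. For points $\mathcal P=(\boldsymbol{x}_1,\dots,\boldsymbol{x}_N)$ in $[0,1)^d$ (repetitions allowed) with real weights $\boldsymbol{w}=(w_1,\dots,w_N)$, the periodic $L_2$-discrepancy is $$L_{2,N}^{\rm per}(\mathcal P,\boldsymbol{w})=\left(\int_{[0,1]^d}\int_{[0,1]^d}\Big(\sum_{j:\,\boldsymbol{x}_j\in B(\boldsymbol{x},\boldsymbol{y})}w_j-{\rm volume}(B(\boldsymbol{x},\boldsymbol{y}))\Big)^2\,{\rm d}\boldsymbol{x}\,{\rm d}\boldsymbol{y}\right)^{1/2},$$ and $L_{2,N}^{\rm per}(\mathcal P)$ denotes the case of equal weights $w_j=1/N$. The initial periodic $L_2$-discrepancy is $$L_{2,0}^{\rm per}=\left(\int_{[0,1]^d}\int_{[0,1]^d}{\rm volume}(B(\boldsymbol{x},\boldsymbol{y}))^2\,{\rm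 d}\boldsymbol{x}\,{\rm d}\boldsymbol{y}\right)^{1/2}.$$ For $\varepsilon\in(0,1)$ and $d\in\mathbb N=\{1,2,\dots\}$ let $N_2^{\rm per}(\varepsilon,d)$ be the smallest $N\in\mathbb N$ for which there are $N$ points $\mathcal P$ in $[0,1)^d$ with $L_{2,N}^{\rm per}(\mathcal P)\le\varepsilon\,L_{2,0}^{\rm per}$. Let $N_2^{\rm per,w}(\varepsilon,d)$ and $N_2^{\rm per,w+}(\varepsilon,d)$ be the smallest $N\in\mathbb N$ for which there are $N$ points $\mathcal P$ in $[0,1)^d$ and arbitrary real weights, respectively nonnegative weights, $\boldsymbol{w}$ with $L_{2,N}^{\rm per}(\mathcal P,\boldsymbol{w})\le\varepsilon\,L_{2,0}^{\rm per}$. **Theorem.** For all $\varepsilon\in(0,1)$ and $d\in\mathbb N$, $$N_2^{\rm per}(\varepsilon,d)\ge\frac{1}{1+\varepsilon^2}\left(\frac32\right)^d\quad\text{and}\quad N_2^{\rm per,w+}(\varepsilon,d)\ge(1-\varepsilon^2)\left(\frac32\right)^d.$$ Moreover, for every $\varepsilon_0\in(0,1)$ there exists $c>0$ such that $$N_2^{\rm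 per,w}(\varepsilon,d)\ge c\cdot 1.0628^d\qquad\text{for all } d\in\mathbb N \text{ and } \varepsilon\in(0,\varepsilon_0).$$ (That is, the inverse of the periodic $L_2$-discrepancy suffers from the curse of dimensionality.) -/

import Mathlib

open MeasureTheory

namespace PeriodicDiscrepancy

noncomputable section

/-- The periodic interval `I(x, y) ⊆ [0, 1)`. -/
def periodicInterval (x y : ℝ) : Set ℝ :=
  if x ≤ y then Set.Ico x y else Set.Ico 0 y ∪ Set.Ico x 1

/-- The periodic box `B(x, y) = I(x₁, y₁) × ⋯ × I(x_d, y_d)`. -/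
def periodicBox {d : ℕ} (x y : Fin d → ℝ) : Set (Fin d → ℝ) :=
  Set.univ.pi fun i => periodicInterval (x i) (y i)

open Classical in
/-- The local discrepancy of the points `P j` with weights `w j` with respect to the set `B`:
the sum of the weights of the points in `B`, minus the Lebesgue measure of `B`. -/
def localDiscrepancy {d N : ℕ} (P : Fin N → Fin d → ℝ) (w : Fin N → ℝ)
    (B : Set (Fin d → ℝ)) : ℝ :=
  (∑ j with P j ∈ B, w j) - (volume B).toReal

/-- The periodic `L₂`-discrepancy of a weighted point set.
`Set.Icc 0 1` is the cube `[0, 1]^d` (coordinatewise order). -/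
def weightedPerL2Discrepancy {d N : ℕ} (P : Fin N → Fin d → ℝ) (w : Fin N → ℝ) : ℝ :=
  Real.sqrt (∫ y in Set.Icc (0 : Fin d → ℝ) 1, ∫ x in Set.Icc (0 : Fin d → ℝ) 1,
    localDiscrepancy P w (periodicBox x y) ^ 2)

/-- The periodic `L₂`-discrepancy of a point set: all weights are `1 / N`. -/
def perL2Discrepancy {d N : ℕ} (P : Fin N → Fin d → ℝ) : ℝ :=
  weightedPerL2Discrepancy P fun _ => 1 / (N : ℝ)

/-- The initial periodic `L₂`-discrepancy in dimension `d`. -/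
def initialPerL2Discrepancy (d : ℕ) : ℝ :=
  Real.sqrt (∫ y in Set.Icc (0 : Fin d → ℝ) 1, ∫ x in Set.Icc (0 : Fin d → ℝ) 1,
    (volume (periodicBox x y)).toReal ^ 2)

/-- All points lie in `[0, 1)^d`. Repeated points are allowed. -/
def InUnitCube {d N : ℕ} (P : Fin N → Fin d → ℝ) : Prop :=
  ∀ j i, P j i ∈ Set.Ico (0 : ℝ) 1

/-- The inverse of the periodic `L₂`-discrepancy. The infimum of an empty set of natural numbers
is `0`, so a positive lower bound also says that the minimum exists. -/
def inversePer (ε : ℝ) (d : ℕ) : ℕ :=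
  sInf {N : ℕ | 0 < N ∧ ∃ P : Fin N → Fin d → ℝ, InUnitCube P ∧
    perL2Discrepancy P ≤ ε * initialPerL2Discrepancy d}

/-- The inverse of the weighted periodic `L₂`-discrepancy, for nonnegative weights. -/
def inversePerNonnegWeights (ε : ℝ) (d : ℕ) : ℕ :=
  sInf {N : ℕ | 0 < N ∧ ∃ (P : Fin N → Fin d → ℝ) (w : Fin N → ℝ), InUnitCube P ∧
    (∀ j, 0 ≤ w j) ∧ weightedPerL2Discrepancy P w ≤ ε * initialPerL2Discrepancy d}

/-- The inverse of the weighted periodic `L₂`-discrepancy, for arbitrary real weights. -/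
def inversePerWeights (ε : ℝ) (d : ℕ) : ℕ :=
  sInf {N : ℕ | 0 < N ∧ ∃ (P : Fin N → Fin d → ℝ) (w : Fin N → ℝ), InUnitCube P ∧
    weightedPerL2Discrepancy P w ≤ ε * initialPerL2Discrepancy d}

end

end PeriodicDiscrepancy

/-!
Modulo one, a point `s` lies in `I(x, y)` exactly when the fractional part of `s - x` is smaller
than that of `y - x`. Expanding the square and integrating one coordinate at a time therefore
expresses the squared discrepancy as `3⁻ᵈ (Q - 2S + 1)`, where `S` is the sum of the weights and `Q`
is the quadratic form of the product kernel `∏ᵢ K(sᵢ - tᵢ)`, with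
`K(u) = 3/2 - 3{u} + 3{u}² = 1 + (3/π²) ∑ₙ cos(2πnu)/n²`; without points this is `3⁻ᵈ`. Hence the
relative error is at most `ε` if and only if `Q - 2S + 1 ≤ ε²`, and an estimate `C S² ≤ N Q`
forces `N ≥ (1 - ε²) C`, or `N ≥ C / (1 + ε²)` if `S = 1`.

For nonnegative weights `C = (3/2)ᵈ`, by keeping the diagonal of `Q` only. For arbitrary weights,
take a positive semidefinite kernel `T` whose Schur square lies below `K` in the Loewner order.
By Schur's product theorem the same holds for the tensor powers, and Vybíral's lower bound for Schur
squares gives `C = T(0)²ᵈ`. Comparing Fourier coefficients shows that a suitable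
`T(u) = a + b cos(2πu)` has `T(0) = 57/50`.

The minima in the statement exist because `K` has mean one: a point set built greedily, each point
being no worse than the average one, has `Q - 2S + 1 ≤ ((3/2)ᵈ - 1)/N` for equal weights.
-/

namespace PeriodicDiscrepancy

noncomputable section

open Real Set

section FractionalPart

variable {E : Type*} [NormedAddCommGroup E] [NormedSpace ℝ E]

lemma intervalIntegral_comp_fract_add (f : ℝ → E) (a : ℝ) :
    ∫ x in (0 : ℝ)..1, f (Int.fract (x + a)) = ∫ x in (0 : ℝ)..1, f x := by
  have periodic : Function.Periodic (fun x : ℝ => f (Int.fract x)) 1 := fun x => by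
    simp only [Int.fract_add_one]
  calc ∫ x in (0 : ℝ)..1, f (Int.fract (x + a))
      = ∫ x in a..a + 1, f (Int.fract x) := by
        rw [intervalIntegral.integral_comp_add_right fun x => f (Int.fract x), zero_add,
          add_comm 1 a]
    _ = ∫ x in (0 : ℝ)..1, f (Int.fract x) := by
        rw [periodic.intervalIntegral_add_eq a 0, zero_add]
    _ = ∫ x in (0 : ℝ)..1, f x :=
        intervalIntegral.integral_congr_Ioo_of_le zero_le_one fun x hx => by
          simp only [Int.fract_eq_self.2 ⟨hx.1.le, hx.2⟩]

lemma intervalIntegral_comp_fract_sub_left (f : ℝ → E) (a : ℝ) :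
    ∫ x in (0 : ℝ)..1, f (Int.fract (a - x)) = ∫ x in (0 : ℝ)..1, f x := by
  have reflect := intervalIntegral.integral_comp_sub_left (a := 0) (b := 1)
    (fun x => f (Int.fract (x + (a - 1)))) 1
  simp only [sub_self, sub_zero, intervalIntegral_comp_fract_add] at reflect
  rw [← reflect]
  exact intervalIntegral.integral_congr fun x _ => by ring_nf

lemma intervalIntegral_ite_lt (f : ℝ → E) {a b c : ℝ} (hac : a ≤ c) (hcb : c ≤ b) :
    ∫ u in a..b, (if c < u then f u else 0) = ∫ u in c..b, f u := by
  have indicator : (fun u => if c < u then f u else 0) = (Ioi c).indicator f := rfl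
  rw [indicator, intervalIntegral.integral_of_le (hac.trans hcb),
    intervalIntegral.integral_of_le hcb, setIntegral_indicator measurableSet_Ioi, Ioc_inter_Ioi,
    sup_eq_right.2 hac]

lemma intervalIntegral_one_sub_max_fract_add {δ : ℝ} (hδ : δ ∈ Icc (0 : ℝ) 1) :
    ∫ u in (0 : ℝ)..1, (1 - max u (Int.fract (u + δ))) = 1 / 2 - δ + δ ^ 2 := by
  have no_wrap : EqOn (fun u => 1 - δ - u) (fun u => 1 - max u (Int.fract (u + δ)))
      (Ioo 0 (1 - δ)) := fun u hu => by
    have : Int.fract (u + δ) = u + δ := Int.fract_eq_self.2 ⟨by linarith [hu.1, hδ.1],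
      by linarith [hu.2]⟩
    simp only [this, max_eq_right (le_add_of_nonneg_right hδ.1)]
    ring
  have wrap : EqOn (fun u => 1 - u) (fun u => 1 - max u (Int.fract (u + δ)))
      (Ioo (1 - δ) 1) := fun u hu => by
    have : Int.fract (u + δ) = u + δ - 1 := Int.fract_eq_iff.2
      ⟨by linarith [hu.1], by linarith [hu.2, hδ.2], 1, by simp⟩
    simp only [this, max_eq_left (show u + δ - 1 ≤ u by linarith [hδ.2])]
  have h₁ : (0 : ℝ) ≤ 1 - δ := sub_nonneg.2 hδ.2
  have h₂ : 1 - δ ≤ 1 := sub_le_self 1 hδ.1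
  rw [← intervalIntegral.integral_add_adjacent_intervals (b := 1 - δ),
    ← intervalIntegral.integral_congr_Ioo_of_le h₁ no_wrap,
    ← intervalIntegral.integral_congr_Ioo_of_le h₂ wrap,
    intervalIntegral.integral_comp_sub_left fun u => u,
    intervalIntegral.integral_comp_sub_left fun u => u, integral_id, integral_id]
  · ring
  · exact (Continuous.intervalIntegrable (by fun_prop) _ _).congr_uIoo
      (uIoo_of_le h₁ ▸ no_wrap)
  · exact (Continuous.intervalIntegrable (by fun_prop) _ _).congr_uIoo (uIoo_of_le h₂ ▸ wrap)

end FractionalPart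

section Arc

/-- The Lebesgue measure on `[0, 1)`. -/
abbrev unitMeasure : Measure ℝ := volume.restrict (Ico 0 1)

instance : IsProbabilityMeasure unitMeasure := ⟨by simp⟩

lemma integral_unitMeasure (f : ℝ → ℝ) : ∫ x, f x ∂unitMeasure = ∫ x in (0 : ℝ)..1, f x := by
  rw [intervalIntegral.integral_of_le zero_le_one, integral_Ico_eq_integral_Ioo,
    integral_Ioc_eq_integral_Ioo]

/-- The length of the arc `I(x, y)`, for `z = (x, y)`. -/
def arcLength (z : ℝ × ℝ) : ℝ := Int.fract (z.2 - z.1)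

/-- The indicator function of `s ∈ I(x, y)`, for `z = (x, y)`. Going around the circle from `x`,
the point `s` is in the arc if it comes before `y`. -/
def arcIndicator (s : ℝ) (z : ℝ × ℝ) : ℝ :=
  if Int.fract (s - z.1) < Int.fract (z.2 - z.1) then 1 else 0

/-- The kernel `3 ∫ ∫ 1_{I(x, y)}(s) 1_{I(x, y)}(t) dx dy`, which has mean one in each
variable. -/
def arcKernel (s t : ℝ) : ℝ := 3 / 2 - 3 * Int.fract (s - t) + 3 * Int.fract (s - t) ^ 2

lemma fract_sub_of_mem_Ico {s x : ℝ} (hs : s ∈ Ico (0 : ℝ) 1) (hx : x ∈ Ico (0 : ℝ) 1) :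
    Int.fract (s - x) = if x ≤ s then s - x else s - x + 1 := by
  split_ifs with h
  · exact Int.fract_eq_self.2 ⟨sub_nonneg.2 h, by linarith [hs.2, hx.1]⟩
  · exact Int.fract_eq_iff.2 ⟨by linarith [hs.1, hx.2], by linarith, -1, by simp⟩

lemma mem_periodicInterval_iff {s x y : ℝ} (hs : s ∈ Ico (0 : ℝ) 1) (hx : x ∈ Ico (0 : ℝ) 1)
    (hy : y ∈ Ico (0 : ℝ) 1) :
    s ∈ periodicInterval x y ↔ Int.fract (s - x) < Int.fract (y - x) := by
  rw [fract_sub_of_mem_Ico hs hx, fract_sub_of_mem_Ico hy hx, periodicInterval]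
  simp only [mem_Ico] at hs hx hy
  split_ifs <;> simp only [mem_Ico, mem_union] <;> grind

lemma volume_periodicInterval {x y : ℝ} (hx : x ∈ Ico (0 : ℝ) 1) (hy : y ∈ Ico (0 : ℝ) 1) :
    (volume (periodicInterval x y)).toReal = arcLength (x, y) := by
  rw [arcLength, fract_sub_of_mem_Ico hy hx, periodicInterval]
  split_ifs with h
  · rw [Real.volume_Ico, ENNReal.toReal_ofReal (sub_nonneg.2 h)]
  · have disjoint : Disjoint (Ico 0 y) (Ico x 1) :=
      disjoint_left.2 fun z hz hz' => by linarith [hz.2, hz'.1]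
    rw [measure_union disjoint measurableSet_Ico, Real.volume_Ico, Real.volume_Ico,
      ENNReal.toReal_add ENNReal.ofReal_ne_top ENNReal.ofReal_ne_top,
      ENNReal.toReal_ofReal (by linarith [hy.1]), ENNReal.toReal_ofReal (by linarith [hx.2])]
    ring

lemma memLp_arcLength : MemLp arcLength 2 (unitMeasure.prod unitMeasure) := by
  have measurable : Measurable arcLength := (measurable_snd.sub measurable_fst).fract
  refine MemLp.of_bound measurable.aestronglyMeasurable 1 (Filter.Eventually.of_forall fun z => ?_)
  rw [Real.norm_eq_abs, arcLength, abs_of_nonneg (Int.fract_nonneg _)]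
  exact (Int.fract_lt_one _).le

lemma memLp_arcIndicator (s : ℝ) : MemLp (arcIndicator s) 2 (unitMeasure.prod unitMeasure) := by
  have measurable : Measurable (arcIndicator s) := Measurable.ite
    (measurableSet_lt (measurable_fst.const_sub s).fract (measurable_snd.sub measurable_fst).fract)
    measurable_const measurable_const
  refine MemLp.of_bound measurable.aestronglyMeasurable 1 (Filter.Eventually.of_forall fun z => ?_)
  rw [arcIndicator]
  split_ifs <;> simp

lemma arcKernel_comm (s t : ℝ) : arcKernel s t = arcKernel t s := by
  rw [arcKernel, arcKernel, ← neg_sub t s]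
  by_cases h : Int.fract (t - s) = 0
  · rw [Int.fract_neg_eq_zero.2 h, h]
  · rw [Int.fract_neg h]
    ring

lemma arcKernel_self (s : ℝ) : arcKernel s s = 3 / 2 := by simp [arcKernel]

lemma arcKernel_nonneg (s t : ℝ) : 0 ≤ arcKernel s t := by
  unfold arcKernel
  nlinarith [sq_nonneg (Int.fract (s - t) - 1 / 2)]

lemma integral_arcKernel (s : ℝ) : ∫ t, arcKernel s t ∂unitMeasure = 1 := by
  simp only [integral_unitMeasure, arcKernel]
  rw [intervalIntegral_comp_fract_sub_left fun u => 3 / 2 - 3 * u + 3 * u ^ 2,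
    intervalIntegral.integral_add (Continuous.intervalIntegrable (by fun_prop) _ _)
      (Continuous.intervalIntegrable (by fun_prop) _ _),
    intervalIntegral.integral_sub (by simp) (Continuous.intervalIntegrable (by fun_prop) _ _),
    intervalIntegral.integral_const_mul, intervalIntegral.integral_const_mul, integral_id,
    integral_pow]
  norm_num

lemma integral_arcLength_mul_arcLength :
    ∫ z, arcLength z * arcLength z ∂(unitMeasure.prod unitMeasure) = 1 / 3 := by
  have inner (x : ℝ) : ∫ y, arcLength (x, y) * arcLength (x, y) ∂unitMeasure = 1 / 3 := by
    simp only [integral_unitMeasure, arcLength, sub_eq_add_neg]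
    rw [intervalIntegral_comp_fract_add fun u => u * u]
    simp only [← sq, integral_pow]
    norm_num
  refine (integral_prod _ (memLp_arcLength.integrable_mul memLp_arcLength)).trans ?_
  simp [inner]

lemma integral_arcIndicator_mul_arcLength (s : ℝ) :
    ∫ z, arcIndicator s z * arcLength z ∂(unitMeasure.prod unitMeasure) = 1 / 3 := by
  have inner (x : ℝ) : ∫ y, arcIndicator s (x, y) * arcLength (x, y) ∂unitMeasure =
      (1 - Int.fract (s - x) ^ 2) / 2 := by
    simp only [integral_unitMeasure, arcIndicator, arcLength, ite_mul, one_mul, zero_mul,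
      sub_eq_add_neg _ x]
    rw [intervalIntegral_comp_fract_add fun u => if Int.fract (s + -x) < u then u else 0,
      intervalIntegral_ite_lt _ (Int.fract_nonneg _) (Int.fract_lt_one _).le, integral_id, one_pow]
  refine (integral_prod _ ((memLp_arcIndicator s).integrable_mul memLp_arcLength)).trans ?_
  simp only [Pi.mul_apply, inner, integral_unitMeasure]
  rw [intervalIntegral_comp_fract_sub_left fun u => (1 - u ^ 2) / 2,
    intervalIntegral.integral_div, intervalIntegral.integral_sub (by simp) (by simp)]
  norm_num

lemma integral_arcIndicator_mul_arcIndicator (s t : ℝ) :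
    ∫ z, arcIndicator s z * arcIndicator t z ∂(unitMeasure.prod unitMeasure) =
      1 / 3 * arcKernel s t := by
  have shift (x : ℝ) : Int.fract (s - x) = Int.fract (Int.fract (t - x) + Int.fract (s - t)) :=
    Int.fract_eq_fract.2 ⟨⌊t - x⌋ + ⌊s - t⌋, by push_cast [Int.fract]; ring⟩
  have inner (x : ℝ) : ∫ y, arcIndicator s (x, y) * arcIndicator t (x, y) ∂unitMeasure =
      1 - max (Int.fract (t - x)) (Int.fract (Int.fract (t - x) + Int.fract (s - t))) := by
    rw [← shift]
    simp only [integral_unitMeasure, arcIndicator, mul_ite, ← ite_and, mul_one, mul_zero,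
      ← max_lt_iff, sub_eq_add_neg _ x]
    rw [intervalIntegral_comp_fract_add fun u =>
        if max (Int.fract (t + -x)) (Int.fract (s + -x)) < u then (1 : ℝ) else 0,
      intervalIntegral_ite_lt _ (le_max_of_le_left (Int.fract_nonneg _))
        (max_le (Int.fract_lt_one _).le (Int.fract_lt_one _).le)]
    simp
  refine (integral_prod _ ((memLp_arcIndicator s).integrable_mul (memLp_arcIndicator t))).trans ?_
  simp only [Pi.mul_apply, inner, integral_unitMeasure]
  rw [intervalIntegral_comp_fract_sub_left fun u => 1 - max u (Int.fract (u + Int.fract (s - t))),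
    intervalIntegral_one_sub_max_fract_add ⟨Int.fract_nonneg _, (Int.fract_lt_one _).le⟩,
    arcKernel]
  ring

end Arc

section ProductSpace

variable {ι : Type*} [Fintype ι]

lemma memLp_two_fintype_prod {α : ι → Type*} [∀ i, MeasurableSpace (α i)]
    {μ : ∀ i, Measure (α i)} [∀ i, SigmaFinite (μ i)] {f : ∀ i, α i → ℝ}
    (hf : ∀ i, MemLp (f i) 2 (μ i)) :
    MemLp (fun x : ∀ i, α i => ∏ i, f i (x i)) 2 (Measure.pi μ) := by
  have measurable : AEStronglyMeasurable (fun x : ∀ i, α i => ∏ i, f i (x i)) (Measure.pi μ) :=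
    Finset.univ.aestronglyMeasurable_fun_prod fun i _ =>
      (hf i).1.comp_quasiMeasurePreserving (Measure.quasiMeasurePreserving_eval μ i)
  rw [memLp_two_iff_integrable_sq measurable]
  simp only [← Finset.prod_pow]
  exact Integrable.fintype_prod_dep fun i => (hf i).integrable_sq

lemma integral_fintype_prod_mul_prod {α : ι → Type*} [∀ i, MeasurableSpace (α i)]
    {μ : ∀ i, Measure (α i)} [∀ i, SigmaFinite (μ i)] (f g : ∀ i, α i → ℝ) :
    ∫ x, (∏ i, f i (x i)) * ∏ i, g i (x i) ∂Measure.pi μ = ∏ i, ∫ x, f i x * g i x ∂μ i := by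
  simp only [← Finset.prod_mul_distrib]
  exact integral_fintype_prod_eq_prod fun i x => f i x * g i x

lemma integral_sum_mul_sub_sq {α : Type*} [MeasurableSpace α] {μ : Measure α} {f : ι → α → ℝ}
    {g : α → ℝ} (hf : ∀ j, MemLp (f j) 2 μ) (hg : MemLp g 2 μ) (w : ι → ℝ) :
    ∫ x, (∑ j, w j * f j x - g x) ^ 2 ∂μ =
      ∑ j, ∑ k, w j * w k * ∫ x, f j x * f k x ∂μ - 2 * ∑ j, w j * ∫ x, f j x * g x ∂μ +
        ∫ x, g x * g x ∂μ := by
  have expand (x : α) : (∑ j, w j * f j x - g x) ^ 2 =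
      ∑ j, ∑ k, w j * w k * (f j x * f k x) - 2 * ∑ j, w j * (f j x * g x) + g x * g x := by
    rw [sub_sq, sq, Finset.sum_mul_sum, mul_assoc 2, Finset.sum_mul, sq]
    simp only [mul_assoc, mul_left_comm (f _ x)]
  have integrable_ff (j k : ι) : Integrable (fun x => w j * w k * (f j x * f k x)) μ :=
    ((hf j).integrable_mul (hf k)).const_mul _
  have integrable_fg (j : ι) : Integrable (fun x => w j * (f j x * g x)) μ :=
    ((hf j).integrable_mul hg).const_mul _
  have integrable_quad : Integrable (fun x => ∑ j, ∑ k, w j * w k * (f j x * f k x)) μ :=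
    integrable_finsetSum _ fun j _ => integrable_finsetSum _ fun k _ => integrable_ff j k
  have integrable_lin : Integrable (fun x => 2 * ∑ j, w j * (f j x * g x)) μ :=
    (integrable_finsetSum _ fun j _ => integrable_fg j).const_mul 2
  have integrable_gg : Integrable (fun x => g x * g x) μ := hg.integrable_mul hg
  simp only [expand]
  rw [integral_add (integrable_quad.sub' integrable_lin) integrable_gg,
    integral_sub integrable_quad integrable_lin, integral_const_mul,
    integral_finsetSum _ fun j _ => integrable_fg j,
    integral_finsetSum _ fun j _ => integrable_finsetSum _ fun k _ => integrable_ff j k]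
  simp only [integral_finsetSum _ fun k _ => integrable_ff _ k, integral_const_mul]

lemma restrict_Icc_eq_pi_unitMeasure :
    (volume : Measure (ι → ℝ)).restrict (Icc 0 1) = Measure.pi fun _ => unitMeasure := by
  rw [volume_pi, ← Measure.restrict_congr_set Measure.univ_pi_Ico_ae_eq_Icc, Measure.restrict_pi_pi]
  rfl

lemma ae_pi_unitMeasure_mem_Ico :
    ∀ᵐ z ∂Measure.pi fun _ : ι => unitMeasure.prod unitMeasure,
      ∀ i, (z i).1 ∈ Ico (0 : ℝ) 1 ∧ (z i).2 ∈ Ico (0 : ℝ) 1 := by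
  have square : ∀ᵐ p ∂unitMeasure.prod unitMeasure, p.1 ∈ Ico (0 : ℝ) 1 ∧ p.2 ∈ Ico (0 : ℝ) 1 := by
    rw [Measure.prod_restrict]
    exact ae_restrict_mem (measurableSet_Ico.prod measurableSet_Ico)
  exact ae_all_iff.2 fun i =>
    (Measure.quasiMeasurePreserving_eval (fun _ : ι => unitMeasure.prod unitMeasure) i).ae square

lemma setIntegral_cube_cube {F : (ι → ℝ) → (ι → ℝ) → ℝ}
    (hF : Integrable (fun z : ι → ℝ × ℝ => F (fun i => (z i).1) fun i => (z i).2)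
      (Measure.pi fun _ => unitMeasure.prod unitMeasure)) :
    ∫ y in Icc (0 : ι → ℝ) 1, ∫ x in Icc (0 : ι → ℝ) 1, F x y =
      ∫ z, F (fun i => (z i).1) (fun i => (z i).2)
        ∂Measure.pi fun _ : ι => unitMeasure.prod unitMeasure := by
  have split := measurePreserving_arrowProdEquivProdArrow ℝ ℝ ι (fun _ => unitMeasure)
    fun _ => unitMeasure
  rw [restrict_Icc_eq_pi_unitMeasure]
  refine (integral_prod_symm (fun p : (ι → ℝ) × (ι → ℝ) => F p.1 p.2) ?_).symm.trans ?_
  · exact (split.integrable_comp_emb (MeasurableEquiv.measurableEmbedding _)).1 hF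
  · exact (split.integral_comp' fun p => F p.1 p.2).symm

end ProductSpace

section BoxKernel

variable {d : ℕ}

/-- The `d`-fold tensor power of `arcKernel`. -/
def boxKernel (x y : Fin d → ℝ) : ℝ := ∏ i, arcKernel (x i) (y i)

lemma boxKernel_comm (x y : Fin d → ℝ) : boxKernel x y = boxKernel y x := by
  simp only [boxKernel, arcKernel_comm]

lemma boxKernel_self (x : Fin d → ℝ) : boxKernel x x = (3 / 2) ^ d := by
  simp only [boxKernel, arcKernel_self, Finset.prod_const, Finset.card_univ, Fintype.card_fin]

lemma boxKernel_nonneg (x y : Fin d → ℝ) : 0 ≤ boxKernel x y :=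
  Finset.prod_nonneg fun _ _ => arcKernel_nonneg _ _

lemma integral_boxKernel (x : Fin d → ℝ) :
    ∫ y, boxKernel x y ∂Measure.pi (fun _ => unitMeasure) = 1 := by
  unfold boxKernel
  rw [integral_fintype_prod_eq_prod fun i => arcKernel (x i)]
  exact Finset.prod_eq_one fun i _ => integral_arcKernel (x i)

lemma integrable_boxKernel (x : Fin d → ℝ) :
    Integrable (boxKernel x) (Measure.pi fun _ => unitMeasure) :=
  .of_integral_ne_zero (by simp [integral_boxKernel])

end BoxKernel

section Warnock

variable {d N : ℕ}

/-- The quadratic form of `boxKernel` at the points `P` and the weights `w`. -/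
def energy (P : Fin N → Fin d → ℝ) (w : Fin N → ℝ) : ℝ :=
  ∑ j, ∑ k, w j * w k * boxKernel (P j) (P k)

/-- The squared periodic discrepancy divided by the squared initial one. -/
def normalizedError (P : Fin N → Fin d → ℝ) (w : Fin N → ℝ) : ℝ :=
  energy P w - 2 * ∑ j, w j + 1

open Classical in
lemma localDiscrepancy_periodicBox {P : Fin N → Fin d → ℝ} (hP : InUnitCube P) (w : Fin N → ℝ)
    {x y : Fin d → ℝ} (hx : ∀ i, x i ∈ Ico (0 : ℝ) 1) (hy : ∀ i, y i ∈ Ico (0 : ℝ) 1) :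
    localDiscrepancy P w (periodicBox x y) =
      ∑ j, w j * ∏ i, arcIndicator (P j i) (x i, y i) - ∏ i, arcLength (x i, y i) := by
  unfold localDiscrepancy periodicBox
  congr 1
  · rw [Finset.sum_filter]
    refine Finset.sum_congr rfl fun j _ => ?_
    simp only [arcIndicator, Finset.prod_ite_zero, Finset.prod_const_one, mem_univ_pi,
      Finset.mem_univ, true_implies, mul_ite, mul_one, mul_zero,
      mem_periodicInterval_iff (hP j _) (hx _) (hy _)]
  · rw [volume_pi_pi, ENNReal.toReal_prod]
    exact Finset.prod_congr rfl fun i _ => volume_periodicInterval (hx i) (hy i)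

lemma integral_localDiscrepancy_sq {P : Fin N → Fin d → ℝ} (hP : InUnitCube P) (w : Fin N → ℝ) :
    ∫ y in Icc (0 : Fin d → ℝ) 1, ∫ x in Icc (0 : Fin d → ℝ) 1,
      localDiscrepancy P w (periodicBox x y) ^ 2 = (1 / 3) ^ d * normalizedError P w := by
  let ν : Measure (Fin d → ℝ × ℝ) := Measure.pi fun _ => unitMeasure.prod unitMeasure
  let f (j : Fin N) (z : Fin d → ℝ × ℝ) : ℝ := ∏ i, arcIndicator (P j i) (z i)
  let g (z : Fin d → ℝ × ℝ) : ℝ := ∏ i, arcLength (z i)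
  have hf (j : Fin N) : MemLp (f j) 2 ν := memLp_two_fintype_prod fun i => memLp_arcIndicator _
  have hg : MemLp g 2 ν := memLp_two_fintype_prod fun _ => memLp_arcLength
  have h_ae : (fun z => (∑ j, w j * f j z - g z) ^ 2) =ᵐ[ν] fun z =>
      localDiscrepancy P w (periodicBox (fun i => (z i).1) fun i => (z i).2) ^ 2 := by
    filter_upwards [ae_pi_unitMeasure_mem_Ico] with z hz
    rw [localDiscrepancy_periodicBox hP w (fun i => (hz i).1) fun i => (hz i).2]
  have h_memLp : MemLp (fun z => ∑ j, w j * f j z - g z) 2 ν :=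
    (memLp_finsetSum _ fun j _ => (hf j).const_mul (w j)).sub hg
  rw [setIntegral_cube_cube (F := fun x y => localDiscrepancy P w (periodicBox x y) ^ 2)
    (h_memLp.integrable_sq.congr h_ae), ← integral_congr_ae h_ae, integral_sum_mul_sub_sq hf hg]
  simp only [f, g, ν, integral_fintype_prod_mul_prod,
    integral_arcLength_mul_arcLength, integral_arcIndicator_mul_arcLength,
    integral_arcIndicator_mul_arcIndicator]
  simp only [Finset.prod_mul_distrib, Finset.prod_const, Finset.card_univ, Fintype.card_fin,
    normalizedError, energy, boxKernel, mul_left_comm _ ((1 / 3 : ℝ) ^ d),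
    mul_comm _ ((1 / 3 : ℝ) ^ d), ← Finset.mul_sum]
  ring

lemma initialPerL2Discrepancy_eq (d : ℕ) : initialPerL2Discrepancy d = √((1 / 3) ^ d) := by
  have no_points := integral_localDiscrepancy_sq (d := d) (N := 0) (P := fun j => j.elim0)
    (fun j => j.elim0) (fun j => j.elim0)
  simp only [localDiscrepancy, normalizedError, energy, Finset.univ_eq_empty, Finset.filter_empty,
    Finset.sum_empty, zero_sub, neg_sq, mul_zero, sub_zero, zero_add, mul_one] at no_points
  rw [initialPerL2Discrepancy, no_points]

lemma weightedPerL2Discrepancy_le_iff {P : Fin N → Fin d → ℝ} (hP : InUnitCube P)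
    (w : Fin N → ℝ) {ε : ℝ} (hε : 0 < ε) :
    weightedPerL2Discrepancy P w ≤ ε * initialPerL2Discrepancy d ↔
      normalizedError P w ≤ ε ^ 2 := by
  have scale_pos : (0 : ℝ) < (1 / 3) ^ d := by positivity
  rw [weightedPerL2Discrepancy, integral_localDiscrepancy_sq hP, initialPerL2Discrepancy_eq,
    Real.sqrt_le_left (by positivity), mul_pow, Real.sq_sqrt scale_pos.le, mul_comm (ε ^ 2)]
  exact mul_le_mul_iff_right₀ scale_pos

end Warnock

section Existence

variable {d : ℕ}

lemma exists_sum_boxKernel_le {N : ℕ} (P : Fin N → Fin d → ℝ) :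
    ∃ x : Fin d → ℝ, (∀ i, x i ∈ Ico (0 : ℝ) 1) ∧ ∑ j, boxKernel (P j) x ≤ N := by
  have in_cube : ∀ᵐ x ∂Measure.pi fun _ : Fin d => unitMeasure, ∀ i, x i ∈ Ico (0 : ℝ) 1 :=
    ae_all_iff.2 fun i => (Measure.quasiMeasurePreserving_eval (fun _ => unitMeasure) i).ae
      (ae_restrict_mem measurableSet_Ico)
  obtain ⟨x, hx, le_mean⟩ := exists_notMem_null_le_integral
    (integrable_finsetSum Finset.univ fun j _ => integrable_boxKernel (P j)) (ae_iff.1 in_cube)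
  rw [integral_finsetSum _ fun j _ => integrable_boxKernel (P j)] at le_mean
  simp only [integral_boxKernel, Finset.sum_const, Finset.card_univ, Fintype.card_fin,
    nsmul_one] at le_mean
  exact ⟨x, not_not.1 hx, le_mean⟩

lemma exists_sum_sum_boxKernel_le (d N : ℕ) : ∃ P : Fin N → Fin d → ℝ, InUnitCube P ∧
    ∑ j, ∑ k, boxKernel (P j) (P k) ≤ N ^ 2 + N * ((3 / 2) ^ d - 1) := by
  induction N with
  | zero => exact ⟨fun j => j.elim0, fun j => j.elim0, by simp⟩
  | succ N ih =>
    obtain ⟨P, hP, energy_le⟩ := ih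
    obtain ⟨x, hx, sum_le⟩ := exists_sum_boxKernel_le P
    refine ⟨Fin.snoc P x, fun j i => ?_, ?_⟩
    · refine Fin.lastCases ?_ (fun j => ?_) j
      · simpa only [Fin.snoc_last] using hx i
      · simpa only [Fin.snoc_castSucc] using hP j i
    · simp only [Fin.sum_univ_castSucc, Fin.snoc_castSucc, Fin.snoc_last, Finset.sum_add_distrib,
        boxKernel_comm x (P _), boxKernel_self]
      push_cast
      linarith

lemma exists_normalizedError_le (d : ℕ) {N : ℕ} (hN : 0 < N) :
    ∃ P : Fin N → Fin d → ℝ, InUnitCube P ∧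
      normalizedError P (fun _ => 1 / N) ≤ ((3 / 2) ^ d - 1) / N := by
  obtain ⟨P, hP, sum_le⟩ := exists_sum_sum_boxKernel_le d N
  have : (0 : ℝ) < N := Nat.cast_pos.2 hN
  refine ⟨P, hP, ?_⟩
  calc normalizedError P (fun _ => 1 / N)
      = (∑ j, ∑ k, boxKernel (P j) (P k)) / N ^ 2 - 1 := by
        simp only [normalizedError, energy, ← Finset.mul_sum, Finset.sum_const, Finset.card_univ,
          Fintype.card_fin, nsmul_eq_mul]
        field_simp
        ring
    _ ≤ (N ^ 2 + N * ((3 / 2) ^ d - 1)) / N ^ 2 - 1 := by gcongr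
    _ = ((3 / 2) ^ d - 1) / N := by
        field_simp
        ring

lemma exists_perL2Discrepancy_le (d : ℕ) {ε : ℝ} (hε : 0 < ε) :
    ∃ N : ℕ, 0 < N ∧ ∃ P : Fin N → Fin d → ℝ, InUnitCube P ∧
      perL2Discrepancy P ≤ ε * initialPerL2Discrepancy d := by
  obtain ⟨N, hN⟩ := exists_nat_gt (((3 / 2) ^ d - 1) / ε ^ 2)
  have hN_pos : 0 < N := Nat.cast_pos.1 <| hN.trans_le' <|
    div_nonneg (sub_nonneg.2 (one_le_pow₀ (by norm_num))) (sq_nonneg ε)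
  obtain ⟨P, hP, error_le⟩ := exists_normalizedError_le d hN_pos
  refine ⟨N, hN_pos, P, hP, (weightedPerL2Discrepancy_le_iff hP _ hε).2 (error_le.trans ?_)⟩
  rw [div_lt_iff₀ (sq_pos_of_pos hε)] at hN
  rw [div_le_iff₀ (Nat.cast_pos.2 hN_pos), mul_comm]
  exact hN.le

end Existence

section LoewnerOrder

open Matrix
open scoped MatrixOrder

variable {n : Type*}

lemma isClosed_setOf_posSemidef : IsClosed {A : Matrix n n ℝ | A.PosSemidef} := by
  have setOf_eq : {A : Matrix n n ℝ | A.PosSemidef} = {A | Aᴴ = A} ∩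
      ⋂ x : n →₀ ℝ, {A | 0 ≤ x.sum fun i xi => x.sum fun j xj => star xi * A i j * xj} := by
    ext A
    simp only [PosSemidef, IsHermitian, mem_inter_iff, mem_iInter, mem_ofPred_eq]
  rw [setOf_eq]
  refine (isClosed_eq (by fun_prop) continuous_id).inter <| isClosed_iInter fun x =>
    isClosed_le continuous_const ?_
  unfold Finsupp.sum
  fun_prop

instance : OrderClosedTopology (Matrix n n ℝ) where
  isClosed_le' := by
    simp only [Matrix.le_iff]
    exact isClosed_setOf_posSemidef.preimage (continuous_snd.sub continuous_fst)

lemma smul_le_smul_of_posSemidef {A : Matrix n n ℝ} (hA : A.PosSemidef) {r s : ℝ} (hrs : r ≤ s) :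
    r • A ≤ s • A := by
  rw [Matrix.le_iff, ← sub_smul]
  exact hA.smul (sub_nonneg.2 hrs)

lemma posSemidef_vecMulVec_self (v : n → ℝ) : (vecMulVec v v).PosSemidef := by
  refine ⟨IsHermitian.ext fun i j => by simp [vecMulVec_apply, mul_comm], fun x => ?_⟩
  have square : (x.sum fun i xi => x.sum fun j xj => star xi * vecMulVec v v i j * xj) =
      (x.sum fun i xi => xi * v i) ^ 2 := by
    simp only [Finsupp.sum, sq, Finset.sum_mul_sum, vecMulVec_apply, star_trivial, mul_assoc,
      mul_comm (v _) (x _)]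
  exact square ▸ sq_nonneg _

lemma posSemidef_of_prod {κ : Type*} (s : Finset κ) {A : κ → Matrix n n ℝ}
    (hA : ∀ l, (A l).PosSemidef) : (of fun i j => ∏ l ∈ s, A l i j).PosSemidef := by
  classical
  induction s using Finset.induction_on with
  | empty =>
    convert! posSemidef_vecMulVec_self (fun _ : n => (1 : ℝ)) using 1
    ext i j
    simp [vecMulVec_apply]
  | insert a s ha ih =>
    convert! (hA a).hadamard ih using 1
    ext i j
    simp [Finset.prod_insert ha]

lemma of_prod_le_of_prod {κ : Type*} (s : Finset κ) {A B : κ → Matrix n n ℝ}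
    (hA : ∀ l, (A l).PosSemidef) (hAB : ∀ l, A l ≤ B l) :
    (of fun i j => ∏ l ∈ s, A l i j) ≤ of fun i j => ∏ l ∈ s, B l i j := by
  classical
  have hB (l : κ) : (B l).PosSemidef := by
    simpa using (hA l).add (Matrix.le_iff.1 (hAB l))
  induction s using Finset.induction_on with
  | empty => simp
  | insert a s ha ih =>
    rw [Matrix.le_iff] at ih ⊢
    convert! ((hB a).hadamard ih).add
      ((Matrix.le_iff.1 (hAB a)).hadamard (posSemidef_of_prod s hA)) using 1
    ext i j
    simp only [Finset.prod_insert ha, hadamard_apply, of_apply, Matrix.add_apply,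
      Matrix.sub_apply]
    ring

variable [Fintype n]

lemma sq_trace_le (M : Matrix n n ℝ) : M.trace ^ 2 ≤ Fintype.card n * (M * Mᵀ).trace := by
  refine (sq_sum_le_card_mul_sum_sq (s := Finset.univ) (f := M.diag)).trans ?_
  rw [Finset.card_univ]
  refine mul_le_mul_of_nonneg_left (Finset.sum_le_sum fun k _ => ?_) (Nat.cast_nonneg _)
  simp only [diag_apply, mul_apply, transpose_apply, ← sq]
  exact Finset.single_le_sum (f := fun l => M k l ^ 2) (fun l _ => sq_nonneg _) (Finset.mem_univ k)

-- Vybíral's inequality. For a Gram matrix `A = BᵀB` it is `sq_trace_le` for `B * diagonal w * Bᵀ`.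
lemma sq_dotProduct_diag_le {A : Matrix n n ℝ} (hA : A.PosSemidef) (w : n → ℝ) :
    (w ⬝ᵥ A.diag) ^ 2 ≤ Fintype.card n * (w ⬝ᵥ (A ⊙ A) *ᵥ w) := by
  classical
  obtain ⟨B, rfl⟩ : ∃ B : Matrix n n ℝ, A = Bᵀ * B :=
    CStarAlgebra.nonneg_iff_eq_star_mul_self.1 hA.nonneg
  have trace_eq : w ⬝ᵥ (Bᵀ * B).diag = (B * diagonal w * Bᵀ).trace := by
    rw [trace_mul_cycle, trace_mul_comm]
    simp only [dotProduct, trace, diag_apply, diagonal_mul]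
  have trace_mul_transpose_eq : w ⬝ᵥ ((Bᵀ * B) ⊙ (Bᵀ * B)) *ᵥ w =
      ((B * diagonal w * Bᵀ) * (B * diagonal w * Bᵀ)ᵀ).trace := by
    rw [dotProduct_mulVec, dotProduct_vecMul_hadamard]
    simp only [transpose_mul, transpose_transpose, diagonal_transpose]
    rw [Matrix.mul_assoc B, Matrix.mul_assoc B, trace_mul_comm B]
    simp only [Matrix.mul_assoc]
  rw [trace_eq, trace_mul_transpose_eq]
  exact sq_trace_le _

end LoewnerOrder

section CosineKernels

open Matrix
open scoped MatrixOrder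

/-- The kernel `cos (2πn(s - t))` on the circle, as an infinite matrix so that the Loewner order
and the Hadamard product apply to it. -/
def cosKernel (n : ℕ) : Matrix ℝ ℝ ℝ := of fun s t => cos (2 * π * n * (s - t))

/-- The trigonometric kernel `a + b cos (2π(s - t))`, a candidate for a Schur square root of a
lower bound for `arcKernel`. -/
def trigKernel (a b : ℝ) : Matrix ℝ ℝ ℝ := a • cosKernel 0 + b • cosKernel 1

lemma posSemidef_cosKernel (n : ℕ) : (cosKernel n).PosSemidef := by
  convert! (posSemidef_vecMulVec_self fun s : ℝ => cos (2 * π * n * s)).add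
    (posSemidef_vecMulVec_self fun s : ℝ => sin (2 * π * n * s)) using 1
  ext s t
  simp only [cosKernel, of_apply, Matrix.add_apply, vecMulVec_apply, mul_sub, cos_sub]

lemma posSemidef_trigKernel {a b : ℝ} (ha : 0 ≤ a) (hb : 0 ≤ b) : (trigKernel a b).PosSemidef :=
  ((posSemidef_cosKernel 0).smul ha).add ((posSemidef_cosKernel 1).smul hb)

lemma trigKernel_self (a b s : ℝ) : trigKernel a b s s = a + b := by
  simp [trigKernel, cosKernel]

lemma trigKernel_hadamard_self (a b : ℝ) :
    trigKernel a b ⊙ trigKernel a b = (a ^ 2 + b ^ 2 / 2) • cosKernel 0 +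
      ((2 * a * b) • cosKernel 1 + (b ^ 2 / 2) • cosKernel 2) := by
  ext s t
  have double_angle : cos (2 * π * (2 : ℕ) * (s - t)) = 2 * cos (2 * π * (s - t)) ^ 2 - 1 := by
    rw [← cos_two_mul]
    push_cast
    ring_nf
  simp only [trigKernel, cosKernel, hadamard_apply, Matrix.add_apply, Matrix.smul_apply, of_apply,
    smul_eq_mul, double_angle, Nat.cast_zero, Nat.cast_one, mul_zero, zero_mul, cos_zero, mul_one]
  ring

lemma cosKernel_fract (n : ℕ) (s t : ℝ) :
    cosKernel n s t = cos (2 * π * n * Int.fract (s - t)) := by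
  rw [cosKernel, of_apply, ← cos_sub_int_mul_two_pi _ (n * ⌊s - t⌋), Int.fract]
  push_cast
  ring_nf

-- Up to constants, `arcKernel` is the second Bernoulli polynomial of `Int.fract (s - t)`. The term
-- `n = 0` vanishes because `3 / 0 = 0`.
lemma hasSum_cosKernel : HasSum (fun n : ℕ => (3 / (π * n) ^ 2) • cosKernel n)
    (of arcKernel - cosKernel 0) := by
  refine Pi.hasSum.2 fun s => Pi.hasSum.2 fun t => ?_
  set x : ℝ := Int.fract (s - t) with hx
  have x_mem : x ∈ Icc (0 : ℝ) 1 := ⟨Int.fract_nonneg _, (Int.fract_lt_one _).le⟩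
  have eval_bernoulli :
      ((Polynomial.bernoulli 2).map (algebraMap ℚ ℝ)).eval x = x ^ 2 - x + 1 / 6 := by
    simp [Polynomial.bernoulli, Finset.sum_range_succ, bernoulli_one,
      bernoulli_eq_bernoulli'_of_ne_one (by decide : 2 ≠ 1)]
    ring
  convert! (hasSum_one_div_nat_pow_mul_cos one_ne_zero x_mem).mul_left (3 / π ^ 2) using 1
  · ext n
    rw [Matrix.smul_apply, cosKernel_fract, smul_eq_mul, ← hx, ← mul_assoc, div_mul_div_comm,
      mul_one, mul_one, mul_pow]
  · rw [Matrix.sub_apply, of_apply, cosKernel_fract, arcKernel, ← hx, mul_one, eval_bernoulli,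
      Nat.cast_zero, mul_zero, zero_mul, cos_zero, Nat.factorial_two]
    field_simp
    ring

lemma cosKernel_add_le_arcKernel :
    cosKernel 0 + ((3 / π ^ 2) • cosKernel 1 + (3 / (2 * π) ^ 2) • cosKernel 2) ≤ of arcKernel := by
  have partial_sum_le := sum_le_hasSum {1, 2} (fun n _ =>
    ((posSemidef_cosKernel n).smul (by positivity : 0 ≤ 3 / (π * n) ^ 2)).nonneg) hasSum_cosKernel
  rw [Finset.sum_pair (OfNat.one_ne_ofNat 2), Nat.cast_one, mul_one, Nat.cast_two,
    mul_comm π] at partial_sum_le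
  exact le_sub_iff_add_le'.1 partial_sum_le

lemma trigKernel_hadamard_self_le {a b : ℝ} (h₀ : a ^ 2 + b ^ 2 / 2 ≤ 1)
    (h₁ : 2 * a * b ≤ 3 / π ^ 2) (h₂ : b ^ 2 / 2 ≤ 3 / (2 * π) ^ 2) :
    trigKernel a b ⊙ trigKernel a b ≤ of arcKernel := by
  rw [trigKernel_hadamard_self]
  refine le_trans (add_le_add ?_ (add_le_add ?_ ?_)) cosKernel_add_le_arcKernel
  · simpa only [one_smul] using smul_le_smul_of_posSemidef (posSemidef_cosKernel 0) h₀
  · exact smul_le_smul_of_posSemidef (posSemidef_cosKernel 1) h₁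
  · exact smul_le_smul_of_posSemidef (posSemidef_cosKernel 2) h₂

end CosineKernels

section LowerBounds

open Matrix
open scoped MatrixOrder

variable {d N : ℕ}

lemma energy_eq_dotProduct_mulVec (P : Fin N → Fin d → ℝ) (w : Fin N → ℝ) :
    energy P w = w ⬝ᵥ (of fun j k => boxKernel (P j) (P k)) *ᵥ w := by
  simp only [energy, dotProduct, mulVec, of_apply, Finset.mul_sum, mul_assoc,
    mul_comm (boxKernel _ _)]

lemma sq_sum_le_card_mul_energy_of_nonneg (P : Fin N → Fin d → ℝ) {w : Fin N → ℝ}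
    (hw : ∀ j, 0 ≤ w j) : (3 / 2) ^ d * (∑ j, w j) ^ 2 ≤ N * energy P w := by
  have diagonal_le : (3 / 2) ^ d * ∑ j, w j ^ 2 ≤ energy P w := by
    rw [Finset.mul_sum]
    refine Finset.sum_le_sum fun j _ => ?_
    rw [← boxKernel_self (P j), mul_comm, sq]
    exact Finset.single_le_sum (f := fun k => w j * w k * boxKernel (P j) (P k))
      (fun k _ => mul_nonneg (mul_nonneg (hw j) (hw k)) (boxKernel_nonneg _ _)) (Finset.mem_univ j)
  calc (3 / 2) ^ d * (∑ j, w j) ^ 2 ≤ (3 / 2) ^ d * (N * ∑ j, w j ^ 2) := by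
        gcongr
        simpa only [Finset.card_univ, Fintype.card_fin] using
          sq_sum_le_card_mul_sum_sq (s := Finset.univ) (f := w)
    _ = N * ((3 / 2) ^ d * ∑ j, w j ^ 2) := mul_left_comm _ _ _
    _ ≤ N * energy P w := by gcongr

lemma sq_sum_le_card_mul_energy {T : Matrix ℝ ℝ ℝ} (hT : T.PosSemidef)
    (hT_le : T ⊙ T ≤ of arcKernel) {c : ℝ} (hc : ∀ s, T s s = c) (P : Fin N → Fin d → ℝ)
    (w : Fin N → ℝ) : (c ^ 2) ^ d * (∑ j, w j) ^ 2 ≤ N * energy P w := by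
  let A (i : Fin d) : Matrix (Fin N) (Fin N) ℝ := T.submatrix (P · i) (P · i)
  let K (i : Fin d) : Matrix (Fin N) (Fin N) ℝ := (of arcKernel).submatrix (P · i) (P · i)
  let G : Matrix (Fin N) (Fin N) ℝ := of fun j k => ∏ i, A i j k
  have hA (i : Fin d) : (A i).PosSemidef := hT.submatrix _
  have hAK (i : Fin d) : A i ⊙ A i ≤ K i := Matrix.le_iff.2 ((Matrix.le_iff.1 hT_le).submatrix _)
  have diag_eq : w ⬝ᵥ G.diag = c ^ d * ∑ j, w j := by
    simp only [G, A, dotProduct, diag_apply, of_apply, submatrix_apply, hc, Finset.prod_const,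
      Finset.card_univ, Fintype.card_fin, ← Finset.sum_mul, mul_comm]
  have hadamard_le : G ⊙ G ≤ of fun j k => boxKernel (P j) (P k) := by
    convert! of_prod_le_of_prod Finset.univ (fun i => (hA i).hadamard (hA i)) hAK using 1
    ext j k
    simp only [G, hadamard_apply, of_apply, Finset.prod_mul_distrib]
  calc (c ^ 2) ^ d * (∑ j, w j) ^ 2 = (w ⬝ᵥ G.diag) ^ 2 := by rw [diag_eq, mul_pow, pow_right_comm]
    _ ≤ N * (w ⬝ᵥ (G ⊙ G) *ᵥ w) := by
        simpa only [Fintype.card_fin] using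
          sq_dotProduct_diag_le (posSemidef_of_prod Finset.univ hA) w
    _ ≤ N * energy P w := by
        have := (Matrix.le_iff.1 hadamard_le).dotProduct_mulVec_nonneg w
        rw [star_trivial, sub_mulVec, dotProduct_sub, sub_nonneg] at this
        rw [energy_eq_dotProduct_mulVec]
        gcongr

-- The weights `a = 99 / 100` and `b = 3 / 20` nearly exhaust the constraints of
-- `trigKernel_hadamard_self_le`; the bound grows with `a + b`.
lemma pow_mul_sq_sum_le_card_mul_energy (P : Fin N → Fin d → ℝ) (w : Fin N → ℝ) :
    ((57 / 50) ^ 2) ^ d * (∑ j, w j) ^ 2 ≤ N * energy P w := by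
  have pi_sq_le : π ^ 2 ≤ 9.9225 := by nlinarith [pi_lt_d2, pi_pos]
  refine sq_sum_le_card_mul_energy (T := trigKernel (99 / 100) (3 / 20))
    (posSemidef_trigKernel (by norm_num) (by norm_num))
    (trigKernel_hadamard_self_le (by norm_num) ?_ ?_)
    (fun s => (trigKernel_self _ _ s).trans (by norm_num)) P w
  · rw [le_div_iff₀ (by positivity)]
    linarith
  · rw [mul_pow, le_div_iff₀ (by positivity)]
    linarith

-- Insert `energy ≥ C S² / N` into `energy - 2S + 1` and minimize over `S = ∑ w`.
lemma le_card_of_normalizedError_le {P : Fin N → Fin d → ℝ} {w : Fin N → ℝ} {C δ : ℝ}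
    (hN : 0 < N) (hC : 0 < C) (h_energy : C * (∑ j, w j) ^ 2 ≤ N * energy P w)
    (h_error : normalizedError P w ≤ δ) : (1 - δ) * C ≤ N := by
  have hN' : (0 : ℝ) < N := Nat.cast_pos.2 hN
  have one_sub_le : 1 - δ ≤ 2 * ∑ j, w j - energy P w := by
    unfold normalizedError at h_error
    linarith
  refine le_of_mul_le_mul_left ?_ hN'
  calc N * ((1 - δ) * C) ≤ N * ((2 * ∑ j, w j - energy P w) * C) := by gcongr
    _ = 2 * (N * C * ∑ j, w j) - C * (N * energy P w) := by ring
    _ ≤ 2 * (N * C * ∑ j, w j) - C * (C * (∑ j, w j) ^ 2) := by gcongr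
    _ ≤ N * N := by linarith [sq_nonneg (N - C * ∑ j, w j)]

lemma le_card_of_normalizedError_const_le {P : Fin N → Fin d → ℝ} {δ : ℝ} (hN : 0 < N)
    (hδ : 0 ≤ δ) (h_error : normalizedError P (fun _ => 1 / N) ≤ δ) :
    1 / (1 + δ) * (3 / 2) ^ d ≤ N := by
  have hN' : (0 : ℝ) < N := Nat.cast_pos.2 hN
  have sum_eq : ∑ _j : Fin N, 1 / (N : ℝ) = 1 := by simp [hN.ne']
  have h_energy := sq_sum_le_card_mul_energy_of_nonneg P (w := fun _ => 1 / (N : ℝ))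
    fun _ => by positivity
  rw [normalizedError, sum_eq] at h_error
  rw [sum_eq, one_pow, mul_one] at h_energy
  rw [one_div_mul_eq_div, div_le_iff₀ (by positivity)]
  exact h_energy.trans (mul_le_mul_of_nonneg_left (by linarith) hN'.le)

end LowerBounds

section Inverse

variable {ε : ℝ}

lemma le_inversePer (d : ℕ) (hε : 0 < ε) :
    1 / (1 + ε ^ 2) * (3 / 2) ^ d ≤ (inversePer ε d : ℝ) := by
  obtain ⟨hN, P, hP, h_le⟩ := Nat.sInf_mem (exists_perL2Discrepancy_le d hε)
  exact le_card_of_normalizedError_const_le hN (sq_nonneg ε)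
    ((weightedPerL2Discrepancy_le_iff hP _ hε).1 h_le)

lemma le_inversePerNonnegWeights (d : ℕ) (hε : 0 < ε) :
    (1 - ε ^ 2) * (3 / 2) ^ d ≤ (inversePerNonnegWeights ε d : ℝ) := by
  obtain ⟨M, hM, Q, hQ, hQ_le⟩ := exists_perL2Discrepancy_le d hε
  obtain ⟨hN, P, w, hP, hw, h_le⟩ := Nat.sInf_mem (s := {N : ℕ | 0 < N ∧
    ∃ (P : Fin N → Fin d → ℝ) (w : Fin N → ℝ), InUnitCube P ∧ (∀ j, 0 ≤ w j) ∧
      weightedPerL2Discrepancy P w ≤ ε * initialPerL2Discrepancy d})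
    ⟨M, hM, Q, _, hQ, fun _ => by positivity, hQ_le⟩
  exact le_card_of_normalizedError_le hN (by positivity) (sq_sum_le_card_mul_energy_of_nonneg P hw)
    ((weightedPerL2Discrepancy_le_iff hP w hε).1 h_le)

lemma le_inversePerWeights (d : ℕ) (hε : 0 < ε) :
    (1 - ε ^ 2) * ((57 / 50) ^ 2) ^ d ≤ (inversePerWeights ε d : ℝ) := by
  obtain ⟨M, hM, Q, hQ, hQ_le⟩ := exists_perL2Discrepancy_le d hε
  obtain ⟨hN, P, w, hP, h_le⟩ := Nat.sInf_mem (s := {N : ℕ | 0 < N ∧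
    ∃ (P : Fin N → Fin d → ℝ) (w : Fin N → ℝ), InUnitCube P ∧
      weightedPerL2Discrepancy P w ≤ ε * initialPerL2Discrepancy d}) ⟨M, hM, Q, _, hQ, hQ_le⟩
  exact le_card_of_normalizedError_le hN (by positivity) (pow_mul_sq_sum_le_card_mul_energy P w)
    ((weightedPerL2Discrepancy_le_iff hP w hε).1 h_le)

end Inverse

end

end PeriodicDiscrepancy

open PeriodicDiscrepancy in
theorem theorem2_general {ε : ℝ} (hε : 0 < ε) (d : ℕ) :
    1 / (1 + ε ^ 2) * (3 / 2) ^ d ≤ (inversePer ε d : ℝ) ∧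
    (1 - ε ^ 2) * (3 / 2) ^ d ≤ (inversePerNonnegWeights ε d : ℝ) ∧
    (1 - ε ^ 2) * ((57 / 50) ^ 2) ^ d ≤ (inversePerWeights ε d : ℝ) :=
  ⟨le_inversePer d hε, le_inversePerNonnegWeights d hε, le_inversePerWeights d hε⟩

theorem theorem2 :
    (∀ (ε : ℝ) (d : ℕ), 0 < ε → ε < 1 → 1 ≤ d →
      1 / (1 + ε ^ 2) * (3 / 2 : ℝ) ^ d ≤ (PeriodicDiscrepancy.inversePer ε d : ℝ) ∧
      (1 - ε ^ 2) * (3 / 2 : ℝ) ^ d ≤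
        (PeriodicDiscrepancy.inversePerNonnegWeights ε d : ℝ)) ∧
    (∀ ε₀ : ℝ, 0 < ε₀ → ε₀ < 1 → ∃ c : ℝ, 0 < c ∧
      ∀ (d : ℕ) (ε : ℝ), 1 ≤ d → 0 < ε → ε < ε₀ →
        c * (1.0628 : ℝ) ^ d ≤ (PeriodicDiscrepancy.inversePerWeights ε d : ℝ)) := by
  refine ⟨fun ε d hε _ _ => ⟨(theorem2_general hε d).1, (theorem2_general hε d).2.1⟩,
    fun ε₀ hε₀ hε₀_lt => ?_⟩
  have hc : 0 < 1 - ε₀ ^ 2 := sub_pos.2 (pow_lt_one₀ hε₀.le hε₀_lt two_ne_zero)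
  refine ⟨1 - ε₀ ^ 2, hc, fun d ε _ hε hε_lt => ?_⟩
  calc (1 - ε₀ ^ 2) * (1.0628 : ℝ) ^ d ≤ (1 - ε₀ ^ 2) * ((57 / 50) ^ 2) ^ d := by
        gcongr
        norm_num
    _ ≤ (1 - ε ^ 2) * ((57 / 50) ^ 2) ^ d := by gcongr
    _ ≤ _ := (theorem2_general hε d).2.2
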